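/- Let $s\ge 0$ and $m\ge 0$ be integers, let $\ell_1,\dots,\ell_s\ge 3$ be integers, and let $\Gamma$ be a (simple) graph whose connected components are $s$ cycles of lengths $\ell_1,\dots,\ell_s$ and one path of length $m$ (that is, with $m$ edges). Let $I=\{i : 1\le i\le s,\ \ell_i \text{ is even}\}$ and put $$m_0 = 2|I|\max\{\ell_i+3 : i\in I\}-1,\qquad m_1 = 7^{\,s-|I|-1}\max\{2\ell_i+1 : 1\le i\le s,\ i\notin I\},$$ where the maximum of the empty set is taken to be $0$. If $$m\ \ge\ 6\max(1,m_0)+7\max(3,m_1)+9,$$ then $\Gamma$ has a graceful labeling: writing $\varepsilon$ for the number of edges of $\Gamma$, there is an injective map $f$ from the vertices of $\Gamma$ to $\{0,1,\dots,\varepsilon\}$ such that the absolute differences $|f(u)-f(v)|$, over the edges $\{u,v\}$ of $\Gamma$, are exactly $1,2,\dots,\varepsilon$, each occurring for exactly one edge. -/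

import Mathlib

/-- The absolute difference of the labels of the two ends of an edge. -/
def edgeDiff {V : Type*} (f : V → ℤ) : Sym2 V → ℤ :=
  Sym2.lift ⟨fun u v => |f u - f v|, fun u v => abs_sub_comm (f u) (f v)⟩

/-- `f` is a graceful labeling of `G`: with `ε` the number of edges of `G`, the vertices receive
distinct labels from `{0, …, ε}`, and the absolute differences along the edges are
`1, …, ε`, each occurring on exactly one edge. (An infinite graph never has such a labeling:
infinitely many vertices do not fit in `{0, …, ε}`.) -/
structure IsGracefulLabeling {V : Type*} (G : SimpleGraph V) (f : V → ℤ) : Prop where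
  injective : Function.Injective f
  mem_Icc : ∀ v, f v ∈ Set.Icc (0 : ℤ) (G.edgeSet.ncard : ℤ)
  bijOn : Set.BijOn (edgeDiff f) G.edgeSet (Set.Icc (1 : ℤ) (G.edgeSet.ncard : ℤ))

/-- The vertex-disjoint union of cycles of lengths `ℓ 0, …, ℓ (s - 1)`. -/
def cyclesGraph {s : ℕ} (ℓ : Fin s → ℕ) : SimpleGraph (Σ i : Fin s, Fin (ℓ i)) :=
  ⨆ i : Fin s, (SimpleGraph.cycleGraph (ℓ i)).map (Function.Embedding.sigmaMk i)

/-- The zillion graph: the vertex-disjoint union of cycles of lengths `ℓ 0, …, ℓ (s - 1)` and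
a path of length `m`, that is, a path with `m` edges and `m + 1` vertices. -/
def zillionGraph {s : ℕ} (ℓ : Fin s → ℕ) (m : ℕ) :
    SimpleGraph ((Σ i : Fin s, Fin (ℓ i)) ⊕ Fin (m + 1)) :=
  (cyclesGraph ℓ).sum (SimpleGraph.pathGraph (m + 1))

/-- The set `I` of the indices of the even cycles. -/
def evenIndices {s : ℕ} (ℓ : Fin s → ℕ) : Finset (Fin s) :=
  Finset.univ.filter fun i => Even (ℓ i)

/-- `m₀ = 2 |I| max {ℓ i + 3 | i ∈ I} - 1`; the maximum of the empty set is `0`. -/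
def evenBound {s : ℕ} (ℓ : Fin s → ℕ) : ℚ :=
  2 * ((evenIndices ℓ).card : ℚ) * (((evenIndices ℓ).sup fun i => ℓ i + 3 : ℕ) : ℚ) - 1

/-- `m₁ = 7 ^ (s - |I| - 1) max {2 ℓ i + 1 | i ∉ I}`; the maximum of the empty set is `0`.
The exponent is an integer; it is `-1` when all the cycles are even. -/
def oddBound {s : ℕ} (ℓ : Fin s → ℕ) : ℚ :=
  (7 : ℚ) ^ ((s : ℤ) - ((evenIndices ℓ).card : ℤ) - 1) *
    (((evenIndices ℓ)ᶜ.sup fun i => 2 * ℓ i + 1 : ℕ) : ℚ)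

/-!
A graceful labelling of a union of cycles and a path uses every label `0, …, n` and every
difference `1, …, n` exactly once, so it is recorded by lists of labels (one list per cycle, one for
the path) whose labels and whose edge differences form the intervals `[0, n]` and `[1, n]` as
multisets: `HasGraceful L n x`, where `L` is the multiset of cycle lengths and `x` is the label of an
end of the path. It is *alpha*, `HasAlpha L a b x`, when every edge joins one of the `a` lowest labels
to one of the `b = a` or `b = a - 1` highest ones. The `i`-th low and the `j`-th highest label differ
by `a + b - 1 - (i + j)`, so an alpha labelling arranges that `i + j` takes every value once. The
other end of the path is required to be the reflection of `x`.

The basic operation is nesting (`HasAlpha.nest_graceful`, `HasAlpha.nest`): the low and the high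
labels of an alpha labelling are moved apart to make room for a graceful labelling with the same
end `x`, and the edge which joins the two paths then has exactly the missing difference. Nesting and
reflection alone produce, from a single vertex, alpha labellings of paths with any even number of
vertices and any prescribed end, and almost all odd ones (`hasAlpha_path_aux`, a Euclidean
recursion).

*Even cycles.* Small explicit alpha labellings of one cycle of length `4 t` or `4 k + 2` with a path
are combined by reflection and nesting into alpha labellings of one even cycle with any large enough
end `x`, and these nest in each other (`hasAlpha_even_cycles`).

*Odd cycles.* An odd cycle needs an edge between two low labels, whose difference must not occur
inside. From a graceful labelling with `n` edges, `HasGraceful.add_odd_cycle_aux` wraps one more odd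
cycle around it: all but one vertex of the cycle are placed next to the inner labelling, and the last
one far away. The path fills the remaining labels in three alpha blocks, which are shifted against
each other by one twice, at the difference taken by the cycle and at the label taken by its far
vertex; one left-over vertex repairs both shifts. This multiplies `n + 3 y`, where `y` is the end, by
about 7, which is the source of the powers of 7 (`exists_hasGraceful_odd_cycles`).

*Combination.* A graceful labelling with `n` edges and end `y` also has, by the reflection
`u ↦ n - u`, the large end `n - y`; around that end all the even cycles are nested at once
(`HasGraceful.add_even_cycles`). The number of edges of the path is adjusted by nesting in paths.
-/

/-! ### Walks and their differences -/

/-- The absolute differences of consecutive entries of a walk. -/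
def stepDiffs : List ℤ → Multiset ℤ
  | [] => 0
  | [_] => 0
  | u :: v :: l => |u - v| ::ₘ stepDiffs (v :: l)

@[simp] theorem stepDiffs_nil : stepDiffs [] = 0 := rfl

@[simp] theorem stepDiffs_singleton (u : ℤ) : stepDiffs [u] = 0 := rfl

@[simp] theorem stepDiffs_cons_cons (u v : ℤ) (l : List ℤ) :
    stepDiffs (u :: v :: l) = |u - v| ::ₘ stepDiffs (v :: l) := rfl

theorem stepDiffs_append {p q : List ℤ} {u v : ℤ} (hp : p.getLast? = some u)
    (hq : q.head? = some v) :
    stepDiffs (p ++ q) = stepDiffs p + {|u - v|} + stepDiffs q := by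
  induction p with
  | nil => simp at hp
  | cons c p ih =>
    cases p with
    | nil =>
      cases q with
      | nil => simp at hq
      | cons d q =>
        simp only [List.getLast?_singleton, Option.some.injEq, List.head?_cons] at hp hq
        subst hp hq
        simp [Multiset.singleton_add]
    | cons d p =>
      rw [List.getLast?_cons_cons] at hp
      have := ih hp
      rw [List.cons_append] at this ⊢
      rw [List.cons_append, stepDiffs_cons_cons, this, stepDiffs_cons_cons]
      simp only [Multiset.cons_add]

theorem stepDiffs_reverse (p : List ℤ) : stepDiffs p.reverse = stepDiffs p := by
  induction p with
  | nil => rfl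
  | cons c p ih =>
    cases p with
    | nil => rfl
    | cons d p =>
      rw [List.reverse_cons, stepDiffs_append (u := d) (v := c) (by simp) rfl, ih, abs_sub_comm,
        stepDiffs_cons_cons, stepDiffs_singleton, add_zero, add_comm, Multiset.singleton_add]

/-- A map which changes the differences of related numbers by `g` changes the differences of a chain
by `g`. -/
theorem stepDiffs_map {R : ℤ → ℤ → Prop} {φ g : ℤ → ℤ} {l : List ℤ} (hl : l.IsChain R)
    (h : ∀ u v, R u v → |φ u - φ v| = g |u - v|) :
    stepDiffs (l.map φ) = (stepDiffs l).map g := by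
  induction l with
  | nil => rfl
  | cons c l ih =>
    cases l with
    | nil => rfl
    | cons d l =>
      rw [List.isChain_cons_cons] at hl
      have := ih hl.2
      simp only [List.map_cons, stepDiffs_cons_cons, Multiset.map_cons] at this ⊢
      rw [this, h _ _ hl.1]

theorem stepDiffs_map_isometry {φ : ℤ → ℤ} (l : List ℤ)
    (h : ∀ u v, |φ u - φ v| = |u - v|) : stepDiffs (l.map φ) = stepDiffs l := by
  have hl : l.IsChain (fun _ _ => True) := by
    induction l with
    | nil => simp
    | cons c l ih => cases l <;> simp_all
  simpa using stepDiffs_map (g := id) hl (fun u v _ => h u v)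

/-- The closed walk around a cycle whose vertices are listed in cyclic order. -/
def closeUp (c : List ℤ) : List ℤ := c ++ c.take 1

theorem closeUp_map (φ : ℤ → ℤ) (c : List ℤ) : closeUp (c.map φ) = (closeUp c).map φ := by
  simp [closeUp, List.map_take]

theorem stepDiffs_closeUp {c : List ℤ} {u v : ℤ} (hu : c.head? = some u)
    (hv : c.getLast? = some v) : stepDiffs (closeUp c) = stepDiffs c + {|v - u|} := by
  have h1 : c.take 1 = [u] := by
    cases c with
    | nil => simp at hu
    | cons d c => simpa using hu
  rw [closeUp, h1, stepDiffs_append hv rfl, stepDiffs_singleton, add_zero]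

/-- All the labels of the cycles `C` and the path `p`. -/
def allLabels (C : List (List ℤ)) (p : List ℤ) : Multiset ℤ := (C.flatten ++ p : List ℤ)

/-- All the edge differences of the cycles `C` and the path `p`. -/
def allDiffs (C : List (List ℤ)) (p : List ℤ) : Multiset ℤ :=
  (C.map fun c => stepDiffs (closeUp c)).sum + stepDiffs p

theorem allLabels_map (φ : ℤ → ℤ) (C : List (List ℤ)) (p : List ℤ) :
    allLabels (C.map (List.map φ)) (p.map φ) = (allLabels C p).map φ := by
  simp [allLabels, List.map_flatten]

theorem allDiffs_map {R : ℤ → ℤ → Prop} {φ g : ℤ → ℤ} {C : List (List ℤ)} {p : List ℤ}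
    (hC : ∀ c ∈ C, (closeUp c).IsChain R) (hp : p.IsChain R)
    (h : ∀ u v, R u v → |φ u - φ v| = g |u - v|) :
    allDiffs (C.map (List.map φ)) (p.map φ) = (allDiffs C p).map g := by
  unfold allDiffs
  rw [Multiset.map_add, stepDiffs_map hp h]
  congr 1
  clear hp
  induction C with
  | nil => simp
  | cons c C ih =>
    have h1 := ih (fun d hd => hC d (List.mem_cons_of_mem _ hd))
    have h2 := stepDiffs_map (hC c List.mem_cons_self) h
    simp only [List.map_cons, List.sum_cons, Multiset.map_add] at h1 ⊢
    rw [h1, closeUp_map, h2]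

theorem allDiffs_map_isometry {φ : ℤ → ℤ} (C : List (List ℤ)) (p : List ℤ)
    (h : ∀ u v, |φ u - φ v| = |u - v|) :
    allDiffs (C.map (List.map φ)) (p.map φ) = allDiffs C p := by
  unfold allDiffs
  simp only [List.map_map, Function.comp_def, closeUp_map]
  simp only [stepDiffs_map_isometry _ h]

theorem allLabels_append (C D : List (List ℤ)) (p q : List ℤ) :
    allLabels (C ++ D) (p ++ q) = allLabels C p + allLabels D q := by
  simp only [allLabels, List.flatten_append, ← Multiset.coe_add]
  abel

theorem allDiffs_append (C D : List (List ℤ)) {p q : List ℤ} {u v : ℤ}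
    (hp : p.getLast? = some u) (hq : q.head? = some v) :
    allDiffs (C ++ D) (p ++ q) = allDiffs C p + {|u - v|} + allDiffs D q := by
  simp only [allDiffs, List.map_append, List.sum_append, stepDiffs_append hp hq]
  abel

/-! ### Intervals of integers as multisets -/

theorem Ico_add_Ico {a b c : ℤ} (h1 : a ≤ b) (h2 : b ≤ c) :
    Multiset.Ico a b + Multiset.Ico b c = Multiset.Ico a c := by
  exact Multiset.Ico_add_Ico_eq_Ico h1 h2

theorem Ico_singleton (a : ℤ) : Multiset.Ico a (a + 1) = {a} := by
  refine (Multiset.Nodup.ext Multiset.nodup_Ico (Multiset.nodup_singleton a)).2 fun x => ?_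
  rw [Multiset.mem_Ico, Multiset.mem_singleton]
  omega

/-- A map with inverse `ψ` between a multiset without repetitions and an interval. -/
theorem map_eq_Ico {S : Multiset ℤ} (hS : S.Nodup) {φ ψ : ℤ → ℤ} {c d : ℤ}
    (h1 : ∀ u ∈ S, c ≤ φ u ∧ φ u < d ∧ ψ (φ u) = u)
    (h2 : ∀ v, c ≤ v → v < d → ψ v ∈ S ∧ φ (ψ v) = v) :
    S.map φ = Multiset.Ico c d := by
  have hn : (S.map φ).Nodup :=
    hS.map_on fun x hx y hy hxy => by rw [← (h1 x hx).2.2, ← (h1 y hy).2.2, hxy]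
  refine (hn.ext Multiset.nodup_Ico).2 fun v => ?_
  rw [Multiset.mem_map, Multiset.mem_Ico]
  constructor
  · rintro ⟨u, hu, rfl⟩
    exact ⟨(h1 u hu).1, (h1 u hu).2.1⟩
  · rintro ⟨h3, h4⟩
    exact ⟨ψ v, h2 v h3 h4⟩

theorem map_add_Ico (a b h : ℤ) :
    (Multiset.Ico a b).map (· + h) = Multiset.Ico (a + h) (b + h) :=
  map_eq_Ico (ψ := (· - h)) Multiset.nodup_Ico (by intro u; simp)
    (by intro v h1 h2; simp only [Multiset.mem_Ico]; omega)

theorem map_sub_Ico (a b h : ℤ) :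
    (Multiset.Ico a b).map (h - ·) = Multiset.Ico (h - b + 1) (h - a + 1) :=
  map_eq_Ico (ψ := (h - ·)) Multiset.nodup_Ico
    (by intro u; simp only [Multiset.mem_Ico]; omega)
    (by intro v h1 h2; simp only [Multiset.mem_Ico]; omega)

/-- The translation of the labels below the threshold `a` by `s`, and of the others by `h`. -/
def spread (a s h u : ℤ) : ℤ := if u < a then u + s else u + h

theorem map_spread_Ico {a b : ℤ} (ha : 0 ≤ a) (hb : 0 ≤ b) (s h : ℤ) :
    (Multiset.Ico 0 (a + b)).map (spread a s h) =
      Multiset.Ico s (s + a) + Multiset.Ico (a + h) (a + b + h) := by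
  rw [← Ico_add_Ico ha (by omega : a ≤ a + b), Multiset.map_add,
    Multiset.map_congr rfl (g := (· + s)) (s := Multiset.Ico 0 a)
      (fun x hx => by rw [Multiset.mem_Ico] at hx; simp [spread, hx.2]),
    Multiset.map_congr rfl (g := (· + h)) (s := Multiset.Ico a (a + b))
      (fun x hx => by rw [Multiset.mem_Ico] at hx; simp [spread, hx.1]),
    map_add_Ico, map_add_Ico, zero_add, add_comm a s]

/-! ### Graceful and alpha labellings as lists -/

/-- One of `u`, `v` lies in `[lo, θ)` and the other one in `[θ, hi)`. -/
def Crosses (lo θ hi u v : ℤ) : Prop :=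
  (lo ≤ u ∧ u < θ ∧ θ ≤ v ∧ v < hi) ∨ (lo ≤ v ∧ v < θ ∧ θ ≤ u ∧ u < hi)

/-- The cycles `C` (lists of labels in cyclic order) and the path `p`, which starts at the label `x`,
form a graceful labelling with `n` edges: the labels are `0, …, n` and the differences `1, …, n`,
each occurring once. -/
structure IsGracefulData (C : List (List ℤ)) (p : List ℤ) (n x : ℤ) : Prop where
  labels : allLabels C p = Multiset.Ico 0 (n + 1)
  diffs : allDiffs C p = Multiset.Ico 1 (n + 1)
  head : p.head? = some x

/-- The cycles `C` and the path `p`, which starts at the label `x`, form a graceful labelling with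
`a + b - 1` edges, in which every edge joins a *low* label, one of the `a` lowest, to a *high* label,
one of the `b` others. The last vertex of the path is the low label `a - 1 - x` or, counted from the
top, the high label with number `a - 1 - x`, according to the parity of the length of the path. -/
structure IsAlphaData (C : List (List ℤ)) (p : List ℤ) (a b x : ℤ) : Prop where
  labels : allLabels C p = Multiset.Ico 0 (a + b)
  diffs : allDiffs C p = Multiset.Ico 1 (a + b)
  head : p.head? = some x
  last : p.getLast? = some (if a = b then b + x else a - 1 - x)
  crosses_path : p.IsChain (Crosses 0 a (a + b))
  crosses_cycle : ∀ c ∈ C, (closeUp c).IsChain (Crosses 0 a (a + b))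
  balanced : a = b ∨ a = b + 1
  nonneg : 0 ≤ x
  lt : x < a

/-- There are cycles whose lengths form the multiset `L`, and a path with an end labelled `x`,
with a graceful labelling with `n` edges in total. -/
def HasGraceful (L : Multiset ℕ) (n x : ℤ) : Prop :=
  ∃ C p, ((C.map List.length : List ℕ) : Multiset ℕ) = L ∧ IsGracefulData C p n x

/-- There are cycles whose lengths form the multiset `L`, and a path which starts at the low
label `x`, with an alpha labelling with `a` low and `b` high labels. -/
def HasAlpha (L : Multiset ℕ) (a b x : ℤ) : Prop :=
  ∃ C p, ((C.map List.length : List ℕ) : Multiset ℕ) = L ∧ IsAlphaData C p a b x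

theorem coe_map_length_map (φ : ℤ → ℤ) (C : List (List ℤ)) :
    (((C.map (List.map φ)).map List.length : List ℕ) : Multiset ℕ) =
      ((C.map List.length : List ℕ) : Multiset ℕ) := by
  simp [Function.comp_def]

theorem coe_map_length_append (C D : List (List ℤ)) :
    (((C ++ D).map List.length : List ℕ) : Multiset ℕ) =
      ((C.map List.length : List ℕ) : Multiset ℕ) + ((D.map List.length : List ℕ) : Multiset ℕ) := by
  simp

theorem IsGracefulData.mem_range {C : List (List ℤ)} {p : List ℤ} {n x : ℤ}
    (h : IsGracefulData C p n x) : 0 ≤ x ∧ x ≤ n := by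
  have h1 : x ∈ allLabels C p := by
    have := List.mem_of_mem_head? h.head
    simp [allLabels, this]
  rw [h.labels, Multiset.mem_Ico] at h1
  omega

theorem HasGraceful.mem_range {L : Multiset ℕ} {n x : ℤ} (h : HasGraceful L n x) :
    0 ≤ x ∧ x ≤ n := by
  obtain ⟨C, p, hL, h⟩ := h
  exact h.mem_range

/-- The reflection `u ↦ n - u`. -/
theorem HasGraceful.compl {L : Multiset ℕ} {n x : ℤ} (h : HasGraceful L n x) :
    HasGraceful L n (n - x) := by
  obtain ⟨C, p, hL, h⟩ := h
  refine ⟨C.map (List.map (n - ·)), p.map (n - ·), by rw [coe_map_length_map, hL], ?_, ?_, ?_⟩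
  · rw [allLabels_map, h.labels, map_sub_Ico]
    congr 1 <;> omega
  · rw [allDiffs_map_isometry _ _ (fun u v => by rw [abs_sub_comm]; congr 1; ring), h.diffs]
  · rw [List.head?_map, h.head, Option.map_some]

theorem IsAlphaData.isGracefulData {C : List (List ℤ)} {p : List ℤ} {a b x : ℤ}
    (h : IsAlphaData C p a b x) : IsGracefulData C p (a + b - 1) x :=
  ⟨by rw [h.labels, sub_add_cancel], by rw [h.diffs, sub_add_cancel], h.head⟩

theorem HasAlpha.graceful {L : Multiset ℕ} {a b x : ℤ} (h : HasAlpha L a b x) :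
    HasGraceful L (a + b - 1) x := by
  obtain ⟨C, p, hL, h⟩ := h
  exact ⟨C, p, hL, h.isGracefulData⟩

/-- A map which preserves or exchanges the two sides preserves chains of crossing edges. -/
theorem isChain_crosses_map {lo θ hi lo' θ' hi' : ℤ} {φ : ℤ → ℤ} {l : List ℤ}
    (hl : l.IsChain (Crosses lo θ hi))
    (h : (∀ u, lo ≤ u → u < θ → lo' ≤ φ u ∧ φ u < θ') ∧
          (∀ u, θ ≤ u → u < hi → θ' ≤ φ u ∧ φ u < hi') ∨
      (∀ u, lo ≤ u → u < θ → θ' ≤ φ u ∧ φ u < hi') ∧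
          (∀ u, θ ≤ u → u < hi → lo' ≤ φ u ∧ φ u < θ')) :
    (l.map φ).IsChain (Crosses lo' θ' hi') := by
  rw [List.isChain_map]
  refine hl.imp fun u v huv => ?_
  rcases h with h | h <;> rcases huv with ⟨h1, h2, h3, h4⟩ | ⟨h1, h2, h3, h4⟩
  · exact Or.inl ⟨(h.1 _ h1 h2).1, (h.1 _ h1 h2).2, (h.2 _ h3 h4).1, (h.2 _ h3 h4).2⟩
  · exact Or.inr ⟨(h.1 _ h1 h2).1, (h.1 _ h1 h2).2, (h.2 _ h3 h4).1, (h.2 _ h3 h4).2⟩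
  · exact Or.inr ⟨(h.2 _ h3 h4).1, (h.2 _ h3 h4).2, (h.1 _ h1 h2).1, (h.1 _ h1 h2).2⟩
  · exact Or.inl ⟨(h.2 _ h3 h4).1, (h.2 _ h3 h4).2, (h.1 _ h1 h2).1, (h.1 _ h1 h2).2⟩

/-- The separate reflections of the low and of the high labels replace a difference `d` by
`a + b - d`. -/
theorem HasAlpha.compl {L : Multiset ℕ} {a b x : ℤ} (h : HasAlpha L a b x) :
    HasAlpha L a b (a - 1 - x) := by
  obtain ⟨C, p, hL, h⟩ := h
  have hab := h.balanced
  have hx := h.nonneg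
  have hxa := h.lt
  set φ : ℤ → ℤ := fun u => if u < a then a - 1 - u else 2 * a + b - 1 - u with hφ
  have hlow : ∀ u, u < a → φ u = a - 1 - u := fun u hu => if_pos hu
  have hhigh : ∀ u, a ≤ u → φ u = 2 * a + b - 1 - u := fun u hu => if_neg (by omega)
  have hcross : ∀ {l : List ℤ}, l.IsChain (Crosses 0 a (a + b)) →
      (l.map φ).IsChain (Crosses 0 a (a + b)) := fun hl =>
    isChain_crosses_map hl (Or.inl ⟨fun u h1 h2 => by rw [hlow u h2]; omega,
      fun u h1 h2 => by rw [hhigh u h1]; omega⟩)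
  have hdiff : ∀ u v, Crosses 0 a (a + b) u v → |φ u - φ v| = a + b - |u - v| := by
    rintro u v (⟨h1, h2, h3, h4⟩ | ⟨h1, h2, h3, h4⟩)
    · rw [hlow u h2, hhigh v h3, abs_of_neg (by omega : u - v < 0), abs_of_neg (by omega)]
      ring
    · rw [hlow v h2, hhigh u h3, abs_of_pos (by omega : 0 < u - v), abs_of_pos (by omega)]
      ring
  refine ⟨C.map (List.map φ), p.map φ, by rw [coe_map_length_map, hL], ?_, ?_, ?_, ?_,
    hcross h.crosses_path, ?_, hab, by omega, by omega⟩
  · rw [allLabels_map, h.labels]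
    refine map_eq_Ico (ψ := φ) Multiset.nodup_Ico (fun u hu => ?_) (fun v h1 h2 => ?_)
    · rw [Multiset.mem_Ico] at hu
      rcases lt_or_ge u a with h1 | h1
      · rw [hlow u h1, hlow _ (by omega)]
        omega
      · rw [hhigh u h1, hhigh _ (by omega)]
        omega
    · rw [Multiset.mem_Ico]
      rcases lt_or_ge v a with h1 | h1
      · rw [hlow v h1, hlow _ (by omega)]
        omega
      · rw [hhigh v h1, hhigh _ (by omega)]
        omega
  · rw [allDiffs_map (g := fun d => a + b - d) h.crosses_cycle h.crosses_path hdiff, h.diffs,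
      map_sub_Ico]
    congr 1 <;> omega
  · rw [List.head?_map, h.head, Option.map_some, hlow x hxa]
  · rw [List.getLast?_map, h.last, Option.map_some]
    congr 1
    split_ifs with h1
    · rw [hhigh _ (by omega)]
      omega
    · rw [hlow _ (by omega)]
  · intro c hc
    obtain ⟨d, hd, rfl⟩ := List.mem_map.1 hc
    rw [closeUp_map]
    exact hcross (h.crosses_cycle d hd)

theorem spread_of_lt {a s h u : ℤ} (hu : u < a) : spread a s h u = u + s := if_pos hu

theorem spread_of_le {a s h u : ℤ} (hu : a ≤ u) : spread a s h u = u + h := if_neg (by omega)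

theorem abs_spread_sub {a b s h u v : ℤ} (hsh : s ≤ h) (huv : Crosses 0 a (a + b) u v) :
    |spread a s h u - spread a s h v| = |u - v| + (h - s) := by
  rcases huv with ⟨h1, h2, h3, h4⟩ | ⟨h1, h2, h3, h4⟩
  · rw [spread_of_lt h2, spread_of_le h3, abs_of_neg (by omega : u - v < 0), abs_of_neg (by omega)]
    ring
  · rw [spread_of_lt h2, spread_of_le h3, abs_of_pos (by omega : 0 < u - v), abs_of_pos (by omega)]
    ring

theorem isChain_crosses_spread {a b s h lo θ hi : ℤ} {l : List ℤ}
    (hl : l.IsChain (Crosses 0 a (a + b))) (h1 : lo ≤ s) (h2 : a + s ≤ θ) (h3 : θ ≤ a + h)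
    (h4 : a + b + h ≤ hi) : (l.map (spread a s h)).IsChain (Crosses lo θ hi) :=
  isChain_crosses_map hl (Or.inl ⟨fun u h5 h6 => by rw [spread_of_lt h6]; omega,
      fun u h5 h6 => by rw [spread_of_le h5]; omega⟩)

/-- The high labels of the outer labelling are raised by `n + 1`, so that its differences are those
above `n + 1`; the inner labelling is moved, by `ψ`, into the gap, and reflected there if the outer
path ends at a low label. The edge from the outer to the inner path has the difference `n + 1`. -/
theorem IsAlphaData.nest_graceful {C D : List (List ℤ)} {p q : List ℤ} {a b x n : ℤ}
    {ψ : ℤ → ℤ} (h : IsAlphaData C p a b x) (hq : IsGracefulData D q n x)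
    (hψ : ψ = if a = b then fun u => u + a else fun u => a + n - u) :
    IsGracefulData (C.map (List.map (spread a 0 (n + 1))) ++ D.map (List.map ψ))
      (p.map (spread a 0 (n + 1)) ++ q.map ψ) (n + a + b) x := by
  have hab := h.balanced
  have hx := h.nonneg
  have hxa := h.lt
  have hn := hq.mem_range
  have hlast : (p.map (spread a 0 (n + 1))).getLast? =
      some (if a = b then b + x + (n + 1) else a - 1 - x) := by
    rw [List.getLast?_map, h.last, Option.map_some]
    congr 1
    split_ifs with h1
    · rw [spread_of_le (by omega)]
    · rw [spread_of_lt (by omega), add_zero]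
  have hhead : (q.map ψ).head? = some (ψ x) := by rw [List.head?_map, hq.head, Option.map_some]
  have hiso : ∀ u v, |ψ u - ψ v| = |u - v| := by
    intro u v
    rw [hψ]
    split_ifs
    · simp
    · rw [abs_sub_comm]
      congr 1
      ring
  have hlink : |(if a = b then b + x + (n + 1) else a - 1 - x) - ψ x| = n + 1 := by
    rw [hψ]
    split_ifs with h1
    · rw [abs_of_pos] <;> dsimp only <;> omega
    · rw [abs_of_neg] <;> dsimp only <;> omega
  have hlab : (Multiset.Ico 0 (n + 1)).map ψ = Multiset.Ico a (a + n + 1) := by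
    rw [hψ]
    split_ifs
    · rw [map_add_Ico]
      congr 1 <;> omega
    · rw [map_sub_Ico]
      congr 1 <;> omega
  refine ⟨?_, ?_, ?_⟩
  · rw [allLabels_append, allLabels_map, allLabels_map, h.labels, hq.labels, hlab,
      map_spread_Ico (by omega) (by omega), zero_add, add_right_comm,
      Ico_add_Ico (by omega) (by omega), ← add_assoc, Ico_add_Ico (by omega) (by omega)]
    congr 1
    ring
  · rw [allDiffs_append _ _ hlast hhead, hlink, allDiffs_map_isometry _ _ hiso, hq.diffs,
      allDiffs_map (g := fun d => d + (n + 1 - 0)) h.crosses_cycle h.crosses_path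
        (fun u v huv => abs_spread_sub (by omega) huv), h.diffs, map_add_Ico, ← Ico_singleton,
      add_comm, add_comm (Multiset.Ico (1 + _) _), ← add_assoc,
      Ico_add_Ico (by omega) (by omega), sub_zero, add_comm 1 (n + 1),
      Ico_add_Ico (by omega) (by omega)]
    congr 1
    ring
  · rw [List.head?_append, List.head?_map, h.head, Option.map_some, spread_of_lt hxa, add_zero]
    rfl

theorem HasAlpha.nest_graceful {L M : Multiset ℕ} {a b x n : ℤ} (h : HasAlpha L a b x)
    (h' : HasGraceful M n x) : HasGraceful (L + M) (n + a + b) x := by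
  obtain ⟨C, p, hL, h⟩ := h
  obtain ⟨D, q, hM, hq⟩ := h'
  exact ⟨_, _, by rw [coe_map_length_append, coe_map_length_map, coe_map_length_map, hL, hM],
    h.nest_graceful hq rfl⟩

/-- Nesting of two alpha labellings. If the outer path ends at a low label, then the low labels of the
inner labelling become high. -/
theorem HasAlpha.nest {L M : Multiset ℕ} {a b a' b' x c d : ℤ} (h : HasAlpha L a b x)
    (h' : HasAlpha M a' b' x)
    (hcd : c = (if a = b then a + a' else a + b') ∧ d = if a = b then b + b' else b + a') :
    HasAlpha (L + M) c d x := by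
  obtain ⟨C, p, hL, h⟩ := h
  obtain ⟨D, q, hM, hq⟩ := h'
  have hab := h.balanced
  have hab' := hq.balanced
  have hx := h.nonneg
  have hxa := h.lt
  have hxa' := hq.lt
  obtain ⟨ψ, hψ⟩ : ∃ ψ : ℤ → ℤ,
      ψ = if a = b then fun u => u + a else fun u => a + (a' + b' - 1) - u := ⟨_, rfl⟩
  have hG := h.nest_graceful hq.isGracefulData hψ
  have hsum : c + d = a' + b' + a + b := by
    split_ifs at hcd <;> omega
  have hout : ∀ {l : List ℤ}, l.IsChain (Crosses 0 a (a + b)) →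
      (l.map (spread a 0 (a' + b' - 1 + 1))).IsChain (Crosses 0 c (c + d)) := fun hl =>
    isChain_crosses_spread hl le_rfl (by split_ifs at hcd <;> omega)
      (by split_ifs at hcd <;> omega) (by omega)
  have hin : ∀ {l : List ℤ}, l.IsChain (Crosses 0 a' (a' + b')) →
      (l.map ψ).IsChain (Crosses 0 c (c + d)) := by
    intro l hl
    refine isChain_crosses_map hl ?_
    rw [hψ]
    by_cases h1 : a = b
    · rw [if_pos h1, if_pos h1] at hcd
      rw [if_pos h1]
      exact Or.inl ⟨fun u _ _ => by omega, fun u _ _ => by omega⟩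
    · rw [if_neg h1, if_neg h1] at hcd
      rw [if_neg h1]
      exact Or.inr ⟨fun u _ _ => by omega, fun u _ _ => by omega⟩
  refine ⟨C.map (List.map (spread a 0 (a' + b' - 1 + 1))) ++ D.map (List.map ψ), _,
    by rw [coe_map_length_append, coe_map_length_map, coe_map_length_map, hL, hM],
    ⟨?_, ?_, hG.head, ?_, ?_, ?_, ?_, hx, ?_⟩⟩
  · rw [hG.labels]
    congr 1
    omega
  · rw [hG.diffs]
    congr 1
    omega
  · rw [List.getLast?_append, List.getLast?_map, hq.last, Option.map_some, Option.some_or, hψ]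
    congr 1
    split_ifs at hcd ⊢ <;> dsimp only <;> omega
  · refine List.IsChain.append (hout h.crosses_path) (hin hq.crosses_path) ?_
    intro u hu v hv
    rw [List.getLast?_map, h.last, Option.map_some, Option.mem_def, Option.some.injEq] at hu
    rw [List.head?_map, hq.head, Option.map_some, Option.mem_def, Option.some.injEq] at hv
    subst hu hv
    rw [hψ]
    split_ifs at hcd ⊢
    · rw [spread_of_le (by omega)]
      right
      dsimp only
      omega
    · rw [spread_of_lt (by omega)]
      left
      dsimp only
      omega
  · intro e he
    rw [List.mem_append] at he
    rcases he with he | he <;> obtain ⟨g, hg, rfl⟩ := List.mem_map.1 he <;> rw [closeUp_map]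
    · exact hout (h.crosses_cycle g hg)
    · exact hin (hq.crosses_cycle g hg)
  · split_ifs at hcd <;> omega
  · split_ifs at hcd <;> omega

/-! ### Alpha labellings of paths -/

theorem hasAlpha_one : HasAlpha 0 1 0 0 := by
  refine ⟨[], [0], rfl, ?_, ?_, rfl, by simp, by simp, by simp, by omega, le_rfl, by omega⟩
  · rw [add_zero, show (1 : ℤ) = 0 + 1 by norm_num, Ico_singleton]
    rfl
  · rw [add_zero, Multiset.Ico_self]
    rfl

/-- The zigzag `0, n, 1, n - 1, …`, which ends at a low or at a high label. -/
theorem hasAlpha_zigzag (k : ℕ) :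
    HasAlpha 0 ((k : ℤ) + 1) k 0 ∧ HasAlpha 0 ((k : ℤ) + 1) (k + 1) 0 := by
  have h1 : HasAlpha 0 1 1 0 := by
    have := hasAlpha_one.nest hasAlpha_one (c := 1) (d := 1) (by norm_num)
    rwa [add_zero] at this
  induction k with
  | zero => exact ⟨by simpa using hasAlpha_one, by simpa using h1⟩
  | succ k ih =>
    have h2 := ih.2.nest hasAlpha_one (c := k + 1 + 1) (d := k + 1) (by simp)
    have h3 := ih.2.nest h1 (c := k + 1 + 1) (d := k + 1 + 1) (by simp)
    rw [add_zero] at h2 h3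
    push_cast
    exact ⟨h2, h3⟩

theorem hasAlpha_descending_odd {x : ℤ} (hx : 0 ≤ x) : HasAlpha 0 (x + 1) x x := by
  lift x to ℕ using hx
  simpa using (hasAlpha_zigzag x).1.compl

theorem hasAlpha_descending_even {x : ℤ} (hx : 0 ≤ x) : HasAlpha 0 (x + 1) (x + 1) x := by
  lift x to ℕ using hx
  simpa using (hasAlpha_zigzag x).2.compl

/-- Paths with `2 a` or `2 a - 1` vertices. The excluded odd case is the one where the two ends would
both be the middle low label. -/
theorem hasAlpha_path_aux (N : ℕ) : ∀ a x : ℤ, a ≤ N → 0 ≤ x → x < a →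
    HasAlpha 0 a a x ∧ (2 * x ≠ a - 1 ∨ x = 0 → HasAlpha 0 a (a - 1) x) := by
  induction N with
  | zero => intro a x _ _ _; omega
  | succ N ih =>
    -- by reflection, the start may be taken in the first half of the low labels
    suffices H : ∀ a x : ℤ, a ≤ N + 1 → 0 ≤ x → x < a → 2 * x ≤ a - 1 →
        HasAlpha 0 a a x ∧ (2 * x ≠ a - 1 ∨ x = 0 → HasAlpha 0 a (a - 1) x) by
      intro a x h1 h2 h3
      push_cast at h1
      by_cases h4 : 2 * x ≤ a - 1
      · exact H a x h1 h2 h3 h4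
      · obtain ⟨h5, h6⟩ := H a (a - 1 - x) h1 (by omega) (by omega) (by omega)
        have h7 := h5.compl
        rw [sub_sub_cancel] at h7
        refine ⟨h7, fun h8 => ?_⟩
        have h9 := (h6 (by omega)).compl
        rwa [sub_sub_cancel] at h9
    intro a x h1 h2 h3 h4
    by_cases h5 : x = 0
    · subst h5
      have h6 := hasAlpha_zigzag (a - 1).toNat
      rw [Int.toNat_of_nonneg (by omega), sub_add_cancel] at h6
      exact ⟨h6.2, fun _ => h6.1⟩
    -- a descending zigzag to `0` leaves a shorter path with the same start; for an even path with
    -- `a = 3 * x + 1` the remaining odd path would be the excluded one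
    have hB := hasAlpha_descending_odd h2
    constructor
    · by_cases h6 : a = 3 * x + 1
      · have h7 := (hasAlpha_descending_even h2).nest (ih (2 * x) x (by omega) h2 (by omega)).1
          (c := a) (d := a) (by simp; omega)
        rwa [add_zero] at h7
      · have h7 := hB.nest ((ih (a - x) x (by omega) h2 (by omega)).2 (by omega))
          (c := a) (d := a) (by simp)
        rwa [add_zero] at h7
    · intro h6
      have h7 := hB.nest (ih (a - 1 - x) x (by omega) h2 (by omega)).1
        (c := a) (d := a - 1) (by simp; omega)
      rwa [add_zero] at h7

theorem hasAlpha_even_path {a x : ℤ} (h1 : 0 ≤ x) (h2 : x < a) : HasAlpha 0 a a x :=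
  (hasAlpha_path_aux a.toNat a x (by omega) h1 h2).1

theorem hasAlpha_odd_path {a x : ℤ} (h1 : 0 ≤ x) (h2 : x < a) (h3 : 2 * x ≠ a - 1) :
    HasAlpha 0 a (a - 1) x :=
  (hasAlpha_path_aux a.toNat a x (by omega) h1 h2).2 (Or.inl h3)

/-- The path is extended by `k` vertices beyond its end `x`. -/
theorem HasGraceful.extend {L : Multiset ℕ} {n x k : ℤ} (h : HasGraceful L n x)
    (h1 : 2 * x + 1 ≤ k) (h2 : k ≠ 4 * x + 1) : HasGraceful L (n + k) x := by
  have hx := h.mem_range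
  rcases Int.even_or_odd' k with ⟨a, rfl | rfl⟩
  · have := (hasAlpha_even_path hx.1 (by omega : x < a)).nest_graceful h
    rw [zero_add] at this
    convert this using 1
    ring
  · have := (hasAlpha_odd_path hx.1 (by omega : x < a + 1) (by omega)).nest_graceful h
    rw [zero_add] at this
    convert this using 1
    ring

theorem hasGraceful_path {n : ℤ} (hn : 0 ≤ n) : HasGraceful 0 n 0 := by
  rcases Int.even_or_odd' n with ⟨a, rfl | rfl⟩
  · have := (hasAlpha_zigzag a.toNat).1.graceful
    rw [Int.toNat_of_nonneg (by omega)] at this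
    convert this using 1
    ring
  · have := (hasAlpha_zigzag a.toNat).2.graceful
    rw [Int.toNat_of_nonneg (by omega)] at this
    convert this using 1
    ring

/-- A path with an alpha labelling, with its low labels moved by `s` and its high labels by `h'`. -/
theorem HasAlpha.exists_spread {a b x : ℤ} (h : HasAlpha 0 a b x) {s h' : ℤ} (hs : s ≤ h') :
    ∃ q : List ℤ, (q : Multiset ℤ) = Multiset.Ico s (s + a) + Multiset.Ico (a + h') (a + b + h') ∧
      stepDiffs q = Multiset.Ico (1 + (h' - s)) (a + b + (h' - s)) ∧ q.head? = some (x + s) ∧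
      q.getLast? = some (if a = b then b + x + h' else a - 1 - x + s) ∧
      ∀ lo θ hi, lo ≤ s → a + s ≤ θ → θ ≤ a + h' → a + b + h' ≤ hi →
        q.IsChain (Crosses lo θ hi) := by
  obtain ⟨C, p, hL, h⟩ := h
  have hC : C = [] := by
    cases C with
    | nil => rfl
    | cons c C => simp at hL
  subst hC
  have hab := h.balanced
  have hx := h.nonneg
  have hxa := h.lt
  have hl : (p : Multiset ℤ) = Multiset.Ico 0 (a + b) := by rw [← h.labels]; rfl
  have hd : stepDiffs p = Multiset.Ico 1 (a + b) := by
    rw [← h.diffs, allDiffs, List.map_nil, List.sum_nil, zero_add]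
  refine ⟨p.map (spread a s h'), ?_, ?_, ?_, ?_, fun lo θ hi h1 h2 h3 h4 =>
    isChain_crosses_spread h.crosses_path h1 h2 h3 h4⟩
  · rw [← Multiset.map_coe, hl, map_spread_Ico (by omega) (by omega)]
  · rw [stepDiffs_map (g := fun d => d + (h' - s)) h.crosses_path
      (fun u v huv => abs_spread_sub hs huv), hd, map_add_Ico]
  · rw [List.head?_map, h.head, Option.map_some, spread_of_lt hxa]
  · rw [List.getLast?_map, h.last, Option.map_some]
    congr 1
    split_ifs with h1
    · rw [spread_of_le (by omega)]
    · rw [spread_of_lt (by omega)]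

/-! ### Alpha labellings with one or more even cycles -/

/-- The indicator function of `[a, ∞)` at `z`. -/
def ind (z a : ℤ) : ℤ := if a ≤ z then 1 else 0

theorem count_Ico_eq_ind (z : ℤ) {a b : ℤ} (h : a ≤ b) :
    ((Multiset.Ico a b).count z : ℤ) = ind z a - ind z b := by
  rw [Multiset.count_eq_of_nodup Multiset.nodup_Ico]
  simp only [Multiset.mem_Ico, ind]
  split_ifs <;> omega

theorem count_singleton_eq_ind (z a : ℤ) :
    (({a} : Multiset ℤ).count z : ℤ) = ind z a - ind z (a + 1) := by
  rw [← Ico_singleton, count_Ico_eq_ind z (by omega)]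

/-- Equality of multisets by multiplicities in `ℤ`. For unions of consecutive intervals,
`count_Ico_eq_ind` turns the sum of the multiplicities into a telescoping sum. -/
theorem multiset_ext_cast {S T : Multiset ℤ} (h : ∀ z, (S.count z : ℤ) = T.count z) : S = T :=
  Multiset.ext.2 fun z => Int.ofNat_injective (h z)

theorem isChain_crosses_closeUp_append {lo θ hi u v u' v' : ℤ} {p q : List ℤ}
    (hp : p.IsChain (Crosses lo θ hi)) (hq : q.IsChain (Crosses lo θ hi))
    (hpu : p.head? = some u) (hpv : p.getLast? = some v) (hqu : q.head? = some u')
    (hqv : q.getLast? = some v') (h1 : Crosses lo θ hi v u') (h2 : Crosses lo θ hi v' u) :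
    (closeUp (p ++ q)).IsChain (Crosses lo θ hi) := by
  have h3 : (p ++ q).take 1 = [u] := by
    cases p with
    | nil => simp at hpu
    | cons d c => simpa using hpu
  rw [closeUp, h3]
  refine List.IsChain.append (hp.append hq ?_) (by simp) ?_
  · intro x hx y hy
    rw [hpv, Option.mem_def, Option.some.injEq] at hx
    rw [hqu, Option.mem_def, Option.some.injEq] at hy
    subst hx hy
    exact h1
  · intro x hx y hy
    rw [List.getLast?_append, hqv, Option.some_or, Option.mem_def, Option.some.injEq] at hx
    rw [List.head?_cons, Option.mem_def, Option.some.injEq] at hy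
    subst hx hy
    exact h2

theorem stepDiffs_closeUp_append {u v u' v' : ℤ} {p q : List ℤ}
    (hpu : p.head? = some u) (hpv : p.getLast? = some v) (hqu : q.head? = some u')
    (hqv : q.getLast? = some v') :
    stepDiffs (closeUp (p ++ q)) = stepDiffs p + {|v - u'|} + stepDiffs q + {|v' - u|} := by
  rw [stepDiffs_closeUp (u := u) (v := v'), stepDiffs_append hpv hqu]
  · rw [List.head?_append, hpu, Option.some_or]
  · rw [List.getLast?_append, hqv, Option.some_or]

theorem coe_length_singleton (c : List ℤ) {n : ℕ} (h : c.length = n) :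
    (([c].map List.length : List ℕ) : Multiset ℕ) = {n} := by
  simp [h]

theorem card_Ico_int (a b : ℤ) : (Multiset.Ico a b).card = (b - a).toNat := by
  rw [Multiset.Ico, Finset.card_val, Int.card_Ico]

/-- The cycle consists of two zigzags with `t` low and `t` high labels each, and the path of the
single vertex `t`, the low label between them. -/
theorem hasAlpha_four_mul {t : ℕ} (ht : 1 ≤ t) :
    HasAlpha {4 * t} (2 * t + 1) (2 * t) t := by
  have hA := hasAlpha_even_path (x := 0) (a := t) le_rfl (by omega)
  obtain ⟨p, hp1, hp2, hp3, hp4, hp5⟩ := hA.exists_spread (s := 0) (h' := 2 * t + 1) (by omega)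
  obtain ⟨q, hq1, hq2, hq3, hq4, hq5⟩ := hA.exists_spread (s := t + 1) (h' := t + 1) (by omega)
  rw [if_pos rfl] at hp4 hq4
  have hlen : (p ++ q).length = 4 * t := by
    have h1 := congrArg Multiset.card hp1
    have h2 := congrArg Multiset.card hq1
    rw [Multiset.card_add, card_Ico_int, card_Ico_int, Multiset.coe_card] at h1 h2
    rw [List.length_append]
    omega
  refine ⟨[p ++ q], [(t : ℤ)], coe_length_singleton _ hlen, ?_, ?_, rfl, ?_, by simp, ?_,
    by omega, by omega, by omega⟩
  · rw [allLabels, List.flatten_singleton, ← Multiset.coe_add, ← Multiset.coe_add, hp1, hq1,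
      Multiset.coe_singleton]
    refine multiset_ext_cast fun z => ?_
    simp (disch := omega) only [Multiset.count_add, Nat.cast_add, count_Ico_eq_ind,
      count_singleton_eq_ind]
    ring_nf
  · rw [allDiffs, List.map_singleton, List.sum_singleton, stepDiffs_closeUp_append hp3 hp4 hq3 hq4,
      hp2, hq2, stepDiffs_singleton]
    refine multiset_ext_cast fun z => ?_
    simp (disch := omega) only [Multiset.count_add, Nat.cast_add, count_Ico_eq_ind,
      count_singleton_eq_ind, abs_of_pos, Multiset.count_zero, Nat.cast_zero]
    ring_nf
  · rw [if_neg (by omega), List.getLast?_singleton]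
    congr 1
    omega
  · intro c hc
    rw [List.mem_singleton] at hc
    subst hc
    exact isChain_crosses_closeUp_append (hp5 _ _ _ (by omega) (by omega) (by omega) (by omega))
      (hq5 _ _ _ (by omega) (by omega) (by omega) (by omega)) hp3 hp4 hq3 hq4
      (Or.inr (by omega)) (Or.inr (by omega))

/-- The cycle consists of an outer zigzag `p` with `k + 1` low and `k` high labels, and an inner one
`q` with `k` low and `k + 1` high labels; the path lies between them, and the two edges joining `p`
and `q` have the two differences left out on both sides of the path. -/
theorem hasAlpha_four_mul_add_two {k : ℕ} (hk : 1 ≤ k) :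
    HasAlpha {4 * k + 2} (3 * k + 1) (3 * k + 1) (k + 1) := by
  have hZ := (hasAlpha_zigzag k).1
  obtain ⟨p, hp1, hp2, hp3, hp4, hp5⟩ := hZ.exists_spread (s := 0) (h' := 4 * k + 1) (by omega)
  obtain ⟨r, hr1, hr2, hr3, hr4, hr5⟩ := hZ.exists_spread (s := 2 * k) (h' := 2 * k) (by omega)
  have hP := hasAlpha_even_path (x := 0) (a := k) le_rfl (by omega)
  obtain ⟨w, hw1, hw2, hw3, hw4, hw5⟩ := hP.exists_spread (s := k + 1) (h' := 3 * k + 2) (by omega)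
  rw [if_neg (by omega)] at hp4 hr4
  rw [if_pos rfl] at hw4
  -- the reflection exchanges the low and the high labels of the second zigzag
  obtain ⟨q, hq⟩ : ∃ q, q = (r.map (6 * (k : ℤ) + 1 - ·)).reverse := ⟨_, rfl⟩
  have hq1 : (q : Multiset ℤ) = Multiset.Ico (2 * k + 1 : ℤ) (3 * k + 1) +
      Multiset.Ico (3 * k + 1 : ℤ) (4 * k + 2) := by
    rw [hq, Multiset.coe_reverse, ← Multiset.map_coe, hr1, Multiset.map_add, map_sub_Ico,
      map_sub_Ico, add_comm]
    congr 2 <;> ring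
  have hq2 : stepDiffs q = Multiset.Ico 1 (2 * k + 1 : ℤ) := by
    rw [hq, stepDiffs_reverse, stepDiffs_map_isometry, hr2]
    · congr 1 <;> ring
    · intro u v
      rw [abs_sub_comm]
      congr 1
      ring
  have hq3 : q.head? = some (3 * k + 1 : ℤ) := by
    rw [hq, List.head?_reverse, List.getLast?_map, hr4, Option.map_some]
    congr 1
    ring
  have hq4 : q.getLast? = some (4 * k + 1 : ℤ) := by
    rw [hq, List.getLast?_reverse, List.head?_map, hr3, Option.map_some]
    congr 1
    ring
  have hq5 : q.IsChain (Crosses 0 (3 * k + 1) (3 * k + 1 + (3 * k + 1))) := by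
    rw [hq, List.isChain_reverse]
    refine (isChain_crosses_map (lo' := 0) (θ' := 3 * k + 1) (hi' := 3 * k + 1 + (3 * k + 1))
      (hr5 (2 * k) (3 * k + 1) (4 * k + 1) (by omega) (by omega) (by omega) (by omega))
      (Or.inr ⟨fun u _ _ => by omega, fun u _ _ => by omega⟩)).imp fun u v huv => Or.symm huv
  have hlen : (p ++ q).length = 4 * k + 2 := by
    have h1 := congrArg Multiset.card hp1
    have h2 := congrArg Multiset.card hq1
    rw [Multiset.card_add, card_Ico_int, card_Ico_int, Multiset.coe_card] at h1 h2
    rw [List.length_append]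
    omega
  refine ⟨[p ++ q], w, coe_length_singleton _ hlen, ?_, ?_, ?_, ?_,
    hw5 _ _ _ (by omega) (by omega) (by omega) (by omega), ?_, Or.inl rfl, by omega, by omega⟩
  · rw [allLabels, List.flatten_singleton, ← Multiset.coe_add, ← Multiset.coe_add, hp1, hq1, hw1]
    refine multiset_ext_cast fun z => ?_
    simp (disch := omega) only [Multiset.count_add, Nat.cast_add, count_Ico_eq_ind]
    ring_nf
  · rw [allDiffs, List.map_singleton, List.sum_singleton, stepDiffs_closeUp_append hp3 hp4 hq3 hq4,
      hp2, hq2, hw2]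
    refine multiset_ext_cast fun z => ?_
    simp (disch := omega) only [Multiset.count_add, Nat.cast_add, count_Ico_eq_ind,
      count_singleton_eq_ind, abs_of_pos, abs_of_neg]
    ring_nf
  · rw [hw3]
    congr 1
    ring
  · rw [hw4, if_pos rfl]
    congr 1
    ring
  · intro c hc
    rw [List.mem_singleton] at hc
    subst hc
    exact isChain_crosses_closeUp_append (hp5 _ _ _ (by omega) (by omega) (by omega) (by omega))
      hq5 hp3 hp4 hq3 hq4 (Or.inl (by omega)) (Or.inr (by omega))

/-- A labelling of the cycle with some start `x₀` is followed by a path; if the number `a` of low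
labels is `x + x₀ + 1`, then the reflection starts at `x`. -/
theorem hasAlpha_even_cycle {l : ℕ} {M x : ℤ} (h3 : 3 ≤ l) (hl : Even l) (hM : l ≤ M)
    (hx : M ≤ x) : ∃ a ≤ x + M, HasAlpha {l} a a x := by
  obtain ⟨h, rfl⟩ := hl
  rcases Nat.even_or_odd' h with ⟨t, rfl | rfl⟩
  · have h1 := (hasAlpha_four_mul (t := t) (by omega)).nest
      (hasAlpha_odd_path (a := x - t + 1) (x := t) (by omega) (by omega) (by omega))
      (c := x + t + 1) (d := x + t + 1) (by rw [if_neg (by omega), if_neg (by omega)]; omega)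
    have h2 := h1.compl
    rw [add_zero] at h2
    refine ⟨x + t + 1, by omega, ?_⟩
    convert h2 using 1
    · congr 1
      ring
    · ring
  · have h1 := (hasAlpha_four_mul_add_two (k := t) (by omega)).nest
      (hasAlpha_even_path (a := x - 2 * t + 1) (x := t + 1) (by omega) (by omega))
      (c := x + t + 2) (d := x + t + 2) (by simp only [if_true]; omega)
    have h2 := h1.compl
    rw [add_zero] at h2
    refine ⟨x + t + 2, by omega, ?_⟩
    convert h2 using 1
    · congr 1
      ring
    · ring

theorem hasAlpha_even_cycles (E : Multiset ℕ) {M x : ℤ} (hM0 : 0 ≤ M) (hx : M ≤ x)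
    (hE : ∀ l ∈ E, 3 ≤ l ∧ Even l ∧ (l : ℤ) ≤ M) (a : ℤ)
    (ha : E.card * (x + M) + x + 1 ≤ a) : HasAlpha E a a x := by
  induction E using Multiset.induction_on generalizing a with
  | empty =>
    rw [Multiset.card_zero] at ha
    exact hasAlpha_even_path (by omega) (by push_cast at ha; linarith)
  | cons l E ih =>
    obtain ⟨h1, h2, h3⟩ := hE l (Multiset.mem_cons_self l E)
    obtain ⟨c, hc, hα⟩ := hasAlpha_even_cycle h1 h2 h3 hx
    rw [Multiset.card_cons] at ha
    push_cast at ha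
    have h4 := ih (fun l hl => hE l (Multiset.mem_cons_of_mem hl)) (a - c) (by linarith)
    have h5 := hα.nest h4 (c := a) (d := a) (by simp)
    rwa [Multiset.singleton_add] at h5

/-! ### Graceful labellings with odd cycles -/

/-- The cycle is a zigzag with the differences above `t`, closed by an edge with difference `t`, around
a path with the labels `t + 1, …, 2 t` and the differences `1, …, t - 1`. -/
theorem hasGraceful_odd_cycle {t : ℕ} (ht : 1 ≤ t) :
    HasGraceful {2 * t + 1} (3 * t) (t + 1) := by
  obtain ⟨p, hp1, hp2, hp3, hp4, -⟩ :=
    (hasAlpha_zigzag t).1.exists_spread (s := 0) (h' := t) (by omega)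
  rw [if_neg (by omega)] at hp4
  obtain ⟨D, q, hD, hq⟩ := hasGraceful_path (n := t - 1) (by omega)
  have hlen : p.length = 2 * t + 1 := by
    have h1 := congrArg Multiset.card hp1
    rw [Multiset.card_add, card_Ico_int, card_Ico_int, Multiset.coe_card] at h1
    omega
  have hD : D = [] := by
    cases D with
    | nil => rfl
    | cons c C => simp at hD
  subst hD
  have hl : (q : Multiset ℤ) = Multiset.Ico 0 (t : ℤ) := by
    rw [← sub_add_cancel (t : ℤ) 1, ← hq.labels]
    rfl
  have hd : stepDiffs q = Multiset.Ico 1 (t : ℤ) := by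
    rw [← sub_add_cancel (t : ℤ) 1, ← hq.diffs, allDiffs, List.map_nil, List.sum_nil, zero_add]
  refine ⟨[p], q.map (· + (t + 1 : ℤ)), coe_length_singleton _ hlen, ?_, ?_, ?_⟩
  · rw [allLabels, List.flatten_singleton, ← Multiset.coe_add, hp1, ← Multiset.map_coe, hl,
      map_add_Ico]
    refine multiset_ext_cast fun z => ?_
    simp (disch := omega) only [Multiset.count_add, Nat.cast_add, count_Ico_eq_ind]
    ring_nf
  · rw [allDiffs, List.map_singleton, List.sum_singleton, stepDiffs_closeUp hp3 hp4, hp2,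
      stepDiffs_map_isometry _ (by simp), hd]
    refine multiset_ext_cast fun z => ?_
    simp (disch := omega) only [Multiset.count_add, Nat.cast_add, count_Ico_eq_ind,
      count_singleton_eq_ind, abs_of_pos]
    ring_nf
  · rw [List.head?_map, hq.head, Option.map_some, zero_add]

theorem getLast?_reverse_append {p q : List ℤ} {u : ℤ} (h : q.head? = some u) :
    (p ++ q.reverse).getLast? = some u := by
  rw [List.getLast?_append, List.getLast?_reverse, h, Option.some_or]

/-- One more odd cycle around a graceful labelling with `n = 2 a - t - 1` edges. With `c = a + y - t`,
the labels are, from the lowest to the highest: `c` low labels of the path `s₁`; the far vertex `c`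
of the cycle; `a - 1` low labels of `q₁`; the first vertex `c + a` of the path; `a` low labels of
`p₁`; `t` low labels of `w`, which is the rest of the cycle; the inner labelling; and the high labels
of `w`, `p₁`, `q₁`, `s₁`. The path runs through `c + a`, `s₁`, `q₁`, `p₁` and the inner path. The
differences increase in the order inner labelling, edge from `p₁` inwards, `w`, the edge from `c` to
the low end of `w`, `p₁`, the edge from `c` to the high end of `w`, the edge from `q₁` to `p₁`, `q₁`,
the edge from `s₁` to `q₁`, the edge from `c + a` to `s₁`, `s₁`. -/
theorem HasGraceful.add_odd_cycle_aux {L : Multiset ℕ} {a y : ℤ} {t : ℕ}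
    (h : HasGraceful L (2 * a - t - 1) y) (ht : 1 ≤ t) (hy : t + 1 ≤ y)
    (hay : y + 2 ≤ a + t) :
    HasGraceful ((2 * t + 1) ::ₘ L) (4 * (2 * a - t - 1) + 2 * y + 3 * t + 3)
      (2 * a - t - 1 + y + 1) := by
  obtain ⟨C, r, hL, hr⟩ := h.compl
  have hyn := h.mem_range
  set n : ℤ := 2 * a - t - 1 with hn
  -- the start `x` of `p₁` gives its edge to the inner path the difference `n + 1`
  obtain ⟨c, hc⟩ : ∃ c : ℤ, c = a + y - t := ⟨_, rfl⟩
  obtain ⟨x, hx⟩ : ∃ x : ℤ, x = a + t - y - 1 := ⟨_, rfl⟩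
  -- the lowest label of the inner labelling
  obtain ⟨I, hI⟩ : ∃ I : ℤ, I = c + 2 * a + t + 1 := ⟨_, rfl⟩
  obtain ⟨w, hw1, hw2, hw3, hw4, -⟩ := (hasAlpha_even_path (a := t) (x := t - 1) (by omega)
    (by omega)).exists_spread (s := I - t) (h' := I + n + 1 - t) (by omega)
  obtain ⟨p₁, hp1, hp2, hp3, hp4, -⟩ := (hasAlpha_even_path (a := a) (x := x) (by omega)
    (by omega)).exists_spread (s := I - t - a) (h' := I + n + 1 + t - a) (by omega)
  obtain ⟨q₁, hq1, hq2, hq3, hq4, -⟩ := (hasAlpha_even_path (a := a - 1) (x := x - 1) (by omega)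
    (by omega)).exists_spread (s := c + 1) (h' := I + n + 1 + t + 1) (by omega)
  obtain ⟨s₁, hs1, hs2, hs3, hs4, -⟩ := (hasAlpha_even_path (a := c) (x := a) (by omega)
    (by omega)).exists_spread (s := 0) (h' := I + n + 1 + t + a + (a - 1) - c) (by omega)
  rw [if_pos rfl] at hw4 hp4 hq4 hs4
  have hlen : (w ++ [c]).length = 2 * t + 1 := by
    have h1 := congrArg Multiset.card hw1
    rw [Multiset.card_add, card_Ico_int, card_Ico_int, Multiset.coe_card] at h1
    rw [List.length_append, List.length_singleton]
    omega
  have hiso : ∀ u v : ℤ, |u + I - (v + I)| = |u - v| := by simp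
  refine ⟨[w ++ [c]] ++ C.map (List.map (· + I)),
    ([c + a] ++ s₁.reverse ++ q₁.reverse ++ p₁.reverse) ++ r.map (· + I), ?_, ?_, ?_, ?_⟩
  · rw [coe_map_length_append, coe_length_singleton _ hlen, coe_map_length_map, hL,
      Multiset.singleton_add]
  · rw [allLabels_append, allLabels_map, hr.labels, map_add_Ico, allLabels, List.flatten_singleton]
    simp only [← Multiset.coe_add, Multiset.coe_reverse, Multiset.coe_singleton, hw1, hp1, hq1, hs1]
    refine multiset_ext_cast fun z => ?_
    simp (disch := omega) only [Multiset.count_add, Nat.cast_add, count_Ico_eq_ind,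
      count_singleton_eq_ind]
    subst hI hx hc
    rw [hn]
    ring_nf
  · rw [allDiffs_append _ _ (getLast?_reverse_append hp3) (by rw [List.head?_map, hr.head]; rfl),
      allDiffs_map_isometry _ _ hiso, hr.diffs, allDiffs, List.map_singleton, List.sum_singleton,
      stepDiffs_closeUp_append hw3 hw4 List.head?_cons List.getLast?_singleton,
      stepDiffs_append (getLast?_reverse_append hq3) (by rw [List.head?_reverse, hp4]),
      stepDiffs_append (getLast?_reverse_append hs3) (by rw [List.head?_reverse, hq4]),
      stepDiffs_append List.getLast?_singleton (by rw [List.head?_reverse, hs4])]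
    simp only [stepDiffs_reverse, stepDiffs_singleton, hw2, hp2, hq2, hs2]
    refine multiset_ext_cast fun z => ?_
    simp (disch := omega) only [Multiset.count_add, Nat.cast_add, count_Ico_eq_ind,
      count_singleton_eq_ind, abs_of_pos, abs_of_neg, Multiset.count_zero, Nat.cast_zero]
    subst hI hx hc
    rw [hn]
    ring_nf
  · simp only [List.cons_append, List.head?_cons]
    congr 1
    omega

/-- If `n` has the wrong parity for `HasGraceful.add_odd_cycle_aux`, then the path is first extended
by `2 y + 1` vertices; this is the worse case in the bound. -/
theorem HasGraceful.add_odd_cycle {L : Multiset ℕ} {n y : ℤ} {t : ℕ} (h : HasGraceful L n y)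
    (ht : 1 ≤ t) (hy : t + 1 ≤ y) (hn : 2 * y ≤ n) :
    ∃ n' y' : ℤ, HasGraceful ((2 * t + 1) ::ₘ L) n' y' ∧ n + y + 1 ≤ y' ∧ 2 * y' ≤ n' ∧
      n' + 3 * y' ≤ 7 * n + 19 * y + 3 * t + 13 := by
  rcases Int.even_or_odd' (n + t + 1) with ⟨a, ha | ha⟩
  · obtain rfl : n = 2 * a - t - 1 := by omega
    exact ⟨_, _, h.add_odd_cycle_aux ht hy (by omega), by omega, by omega, by omega⟩
  · have h1 := h.extend (k := 2 * y + 1) le_rfl (by omega)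
    obtain ⟨b, hb⟩ : ∃ b, b = a + y + 1 := ⟨_, rfl⟩
    have h2 : n + (2 * y + 1) = 2 * b - t - 1 := by omega
    rw [h2] at h1
    exact ⟨_, _, h1.add_odd_cycle_aux ht hy (by omega), by omega, by omega, by omega⟩

/-- The bound is propagated by `n' + 3 y' ≤ 7 (n + 3 y) - 2 y + 3 t + 13` and `T + 1 ≤ y`. -/
theorem exists_hasGraceful_odd_cycles {T : ℕ} (hT : 1 ≤ T) (τ : Multiset ℕ)
    (hτ : ∀ t ∈ τ, 1 ≤ t ∧ t ≤ T) :
    ∃ n y : ℤ, HasGraceful ((2 * T + 1) ::ₘ τ.map fun t => 2 * t + 1) n y ∧ T + 1 ≤ y ∧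
      2 * y ≤ n ∧ 6 * (n + 3 * y) + T + 11 ≤ 7 ^ τ.card * (49 * T + 47) := by
  induction τ using Multiset.induction_on with
  | empty =>
    have h := (hasGraceful_odd_cycle hT).extend (k := 2 * (T + 1) + 1) le_rfl (by omega)
    refine ⟨_, _, by simpa using h, by omega, by omega, ?_⟩
    rw [Multiset.card_zero, pow_zero]
    omega
  | cons t τ ih =>
    obtain ⟨n, y, h, h1, h2, h3⟩ := ih fun t ht => hτ t (Multiset.mem_cons_of_mem ht)
    obtain ⟨ht1, ht2⟩ := hτ t (Multiset.mem_cons_self t τ)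
    obtain ⟨n', y', h', h4, h5, h6⟩ := h.add_odd_cycle ht1 (by omega) h2
    refine ⟨n', y', ?_, by omega, h5, ?_⟩
    · rwa [Multiset.map_cons, Multiset.cons_swap]
    · rw [Multiset.card_cons, pow_succ, mul_comm _ 7, mul_assoc]
      linarith [(Nat.cast_le (α := ℤ)).2 ht2]

/-! ### Combination of the even and the odd cycles -/

theorem HasGraceful.add_even_cycles {S E : Multiset ℕ} {n y M N : ℤ} (h : HasGraceful S n y)
    (hM0 : 0 ≤ M) (hE : ∀ l ∈ E, 3 ≤ l ∧ Even l ∧ (l : ℤ) ≤ M)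
    (h1 : 3 * n + 4 * y + 2 * M + 15 ≤ N)
    (h2 : 3 * (E.card * (2 * M + 5)) + y + 2 * M + 12 ≤ N) :
    ∃ x, HasGraceful (E + S) N x := by
  have hy := h.mem_range
  -- the start `x` is adjusted modulo 3; the second candidate avoids the exceptional length
  obtain ⟨x, n', hx1, hx2, hn, hne⟩ : ∃ x n' : ℤ, M ≤ x ∧ x ≤ M + 5 ∧
      3 * n' = N + 2 * y - 2 - 2 * x ∧ n' - n ≠ 4 * y + 1 := by
    obtain ⟨x, n', hx1, hx2, hn⟩ : ∃ x n' : ℤ, M ≤ x ∧ x ≤ M + 2 ∧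
        3 * n' = N + 2 * y - 2 - 2 * x := by
      have h3 : (N + 2 * y - 2 - 2 * M) % 3 = 0 ∨ (N + 2 * y - 2 - 2 * M) % 3 = 1 ∨
        (N + 2 * y - 2 - 2 * M) % 3 = 2 := by omega
      rcases h3 with h3 | h3 | h3
      · exact ⟨M, (N + 2 * y - 2 - 2 * M) / 3, by omega, by omega, by omega⟩
      · exact ⟨M + 2, (N + 2 * y - 2 - 2 * (M + 2)) / 3, by omega, by omega, by omega⟩
      · exact ⟨M + 1, (N + 2 * y - 2 - 2 * (M + 1)) / 3, by omega, by omega, by omega⟩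
    by_cases h4 : n' - n = 4 * y + 1
    · exact ⟨x + 3, n' - 2, by omega, by omega, by omega, by omega⟩
    · exact ⟨x, n', by omega, by omega, by omega, by omega⟩
  have h3 := (h.extend (k := n' - n) (by omega) hne).compl
  have h4 : (E.card : ℤ) * (x + M) ≤ E.card * (2 * M + 5) :=
    mul_le_mul_of_nonneg_left (by omega) (by positivity)
  have h5 := (hasAlpha_even_cycles E hM0 hx1 hE (n' - y + 1 + x) (by omega)).compl
  rw [show n' - y + 1 + x - 1 - x = n + (n' - n) - y by ring] at h5
  have h6 := h5.nest_graceful h3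
  rw [show n + (n' - n) + (n' - y + 1 + x) + (n' - y + 1 + x) = N by omega] at h6
  exact ⟨_, h6⟩

theorem exists_hasGraceful_of_odd {ι : Type*} [DecidableEq ι] (o : Finset ι) (ℓ : ι → ℕ)
    (hℓ : ∀ i ∈ o, 3 ≤ ℓ i ∧ Odd (ℓ i)) :
    ∃ n y : ℤ, HasGraceful (o.val.map ℓ) n y ∧
      ((3 * n + 4 * y : ℤ) : ℚ) ≤ 7 * max 3
        ((7 : ℚ) ^ ((o.card : ℤ) - 1) * ((o.sup fun i => 2 * ℓ i + 1 : ℕ) : ℚ)) := by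
  rcases o.eq_empty_or_nonempty with rfl | ho
  · exact ⟨0, 0, by simpa using hasGraceful_path le_rfl, by simp⟩
  · obtain ⟨i, hi, hmax⟩ := o.exists_max_image ℓ ho
    obtain ⟨T, hT⟩ := (hℓ i hi).2
    have hT1 : 1 ≤ T := by have := (hℓ i hi).1; omega
    obtain ⟨n, y, h, h1, h2, h3⟩ := exists_hasGraceful_odd_cycles hT1
      ((o.erase i).val.map fun j => ℓ j / 2) (by
        intro t ht
        obtain ⟨j, hj, rfl⟩ := Multiset.mem_map.1 ht
        have hj := Finset.mem_of_mem_erase hj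
        have := hmax j hj
        have := (hℓ j hj).1
        omega)
    refine ⟨n, y, ?_, ?_⟩
    · convert h using 1
      rw [Multiset.map_map, ← hT]
      conv_lhs => rw [← Finset.insert_erase hi]
      rw [Finset.insert_val_of_notMem (Finset.notMem_erase i o), Multiset.map_cons]
      congr 1
      refine Multiset.map_congr rfl fun j hj => ?_
      obtain ⟨k, hk⟩ := (hℓ j (Finset.mem_of_mem_erase hj)).2
      simp only [Function.comp_apply]
      omega
    · have hcard : o.card = (o.erase i).card + 1 := (Finset.card_erase_add_one hi).symm
      rw [Multiset.card_map, Finset.card_val] at h3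
      have hsup : 4 * T + 3 ≤ o.sup fun i => 2 * ℓ i + 1 := by
        have := Finset.le_sup (f := fun i => 2 * ℓ i + 1) hi
        omega
      generalize hS : (o.sup fun i => 2 * ℓ i + 1) = S at hsup
      rw [hcard, Nat.cast_add, Nat.cast_one, add_sub_cancel_right, zpow_natCast]
      refine le_trans ?_ (mul_le_mul_of_nonneg_left (le_max_right _ _) (by norm_num))
      generalize (o.erase i).card = k at h3
      have h4 : (3 * n + 4 * y : ℤ) ≤ 7 * (7 ^ k * S) := by
        have h5 : (7 : ℤ) ^ k * (4 * T + 3) ≤ 7 ^ k * S :=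
          mul_le_mul_of_nonneg_left (by exact_mod_cast hsup) (by positivity)
        have h6 : (0 : ℤ) ≤ 7 ^ k * (7 * T - 5) := mul_nonneg (by positivity) (by omega)
        linarith
      exact_mod_cast h4

theorem exists_hasGraceful_cycles_path {s : ℕ} (ℓ : Fin s → ℕ) (m : ℕ) (hℓ : ∀ i, 3 ≤ ℓ i)
    (hm : 6 * max 1 (evenBound ℓ) + 7 * max 3 (oddBound ℓ) + 9 ≤ (m : ℚ)) :
    ∃ x, HasGraceful (Finset.univ.val.map ℓ) (m + ∑ i, ℓ i : ℕ) x := by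
  have hodd : ∀ i ∈ (evenIndices ℓ)ᶜ, 3 ≤ ℓ i ∧ Odd (ℓ i) := fun i hi =>
    ⟨hℓ i, by simpa [evenIndices] using hi⟩
  have heven : ∀ i ∈ evenIndices ℓ, Even (ℓ i) := fun i hi => by simpa [evenIndices] using hi
  obtain ⟨n, y, h, hny⟩ := exists_hasGraceful_of_odd _ ℓ hodd
  have hcard : (((evenIndices ℓ)ᶜ.card : ℕ) : ℤ) = s - (evenIndices ℓ).card := by
    have := Finset.card_add_card_compl (evenIndices ℓ)
    rw [Fintype.card_fin] at this
    omega
  rw [hcard] at hny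
  have hm1 : 6 * max 1 (evenBound ℓ) + ((3 * n + 4 * y : ℤ) : ℚ) + 9 ≤ (m : ℚ) := by
    unfold oddBound at hm
    linarith
  have hy := h.mem_range
  have hsplit : (evenIndices ℓ).val.map ℓ + (evenIndices ℓ)ᶜ.val.map ℓ =
      Finset.univ.val.map ℓ := by
    rw [← Multiset.map_add]
    congr 1
    rw [← Finset.disjUnion_val _ _ disjoint_compl_right, Finset.disjUnion_eq_union,
      Finset.union_compl]
  rw [← hsplit]
  obtain ⟨M, hM⟩ : ∃ M, M = (evenIndices ℓ).sup ℓ := ⟨_, rfl⟩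
  have hbound : (M = 0 ∧ (evenIndices ℓ).card = 0 ∧ 3 * n + 4 * y + 15 ≤ (m : ℤ)) ∨
      (1 ≤ (evenIndices ℓ).card ∧
        12 * ((evenIndices ℓ).card * (M + 3)) + 3 + (3 * n + 4 * y) ≤ (m : ℤ)) := by
    rcases (evenIndices ℓ).eq_empty_or_nonempty with h0 | h0
    · left
      refine ⟨by rw [hM, h0]; rfl, by rw [h0]; rfl, ?_⟩
      have h1 := le_max_left 1 (evenBound ℓ)
      have h2 : ((3 * n + 4 * y : ℤ) : ℚ) + 15 ≤ (m : ℚ) := by linarith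
      exact_mod_cast h2
    · right
      refine ⟨h0.card_pos, ?_⟩
      obtain ⟨i, hi, hiM⟩ := Finset.exists_mem_eq_sup _ h0 ℓ
      have h1 : M + 3 ≤ (evenIndices ℓ).sup fun i => ℓ i + 3 := by
        rw [hM, hiM]
        exact Finset.le_sup (f := fun i => ℓ i + 3) hi
      have h2 := le_max_right 1 (evenBound ℓ)
      have h3 : (2 * (evenIndices ℓ).card * (M + 3 : ℕ) : ℚ) - 1 ≤ evenBound ℓ := by
        unfold evenBound
        gcongr
      have h4 : (12 * ((evenIndices ℓ).card * (M + 3 : ℕ)) + 3 : ℚ) +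
          ((3 * n + 4 * y : ℤ) : ℚ) ≤ (m : ℚ) := by linarith
      exact_mod_cast h4
  have hsum : (m : ℤ) ≤ (m + ∑ i, ℓ i : ℕ) := by exact_mod_cast Nat.le_add_right _ _
  refine h.add_even_cycles (M := M) (by omega) (fun l hl => ?_) ?_ ?_
  · obtain ⟨i, hi, rfl⟩ := Multiset.mem_map.1 hl
    exact ⟨hℓ i, heven i hi, by rw [hM]; exact_mod_cast Finset.le_sup hi⟩
  · rcases hbound with ⟨h1, h2, h3⟩ | ⟨h1, h2⟩
    · omega
    · have : (1 : ℤ) * (M + 3) ≤ (evenIndices ℓ).card * (M + 3) :=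
        mul_le_mul_of_nonneg_right (by exact_mod_cast h1) (by positivity)
      linarith
  · rw [Multiset.card_map, Finset.card_val]
    rcases hbound with ⟨h1, h2, h3⟩ | ⟨h1, h2⟩
    · rw [h1, h2]
      simp only [Nat.cast_zero, zero_mul, mul_zero]
      omega
    · have : (1 : ℤ) * (M + 3) ≤ (evenIndices ℓ).card * (M + 3) :=
        mul_le_mul_of_nonneg_right (by exact_mod_cast h1) (by positivity)
      linarith

/-! ### From lists to labellings of the graph -/

theorem cycleGraph_adj_iff_eq_add_one {n : ℕ} [NeZero n] (hn : 2 ≤ n) (u v : Fin n) :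
    (SimpleGraph.cycleGraph n).Adj u v ↔ v = u + 1 ∨ u = v + 1 := by
  obtain ⟨k, rfl⟩ : ∃ k, n = k + 2 := ⟨n - 2, by omega⟩
  rw [SimpleGraph.cycleGraph_adj, sub_eq_iff_eq_add', sub_eq_iff_eq_add', or_comm]

/-- The `j`-th edge of the `i`-th cycle joins `j` to `j + 1`, cyclically. -/
theorem zillionGraph_edgeSet {s : ℕ} (ℓ : Fin s → ℕ) (m : ℕ) (hℓ : ∀ i, 3 ≤ ℓ i)
    [∀ i, NeZero (ℓ i)] :
    (zillionGraph ℓ m).edgeSet = Set.range (Sum.elim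
      (fun x : Σ i, Fin (ℓ i) => s(Sum.inl x, Sum.inl ⟨x.1, x.2 + 1⟩))
      (fun j : Fin m => s(Sum.inr j.castSucc, Sum.inr j.succ))) := by
  have hcyc : ∀ x y : Σ i, Fin (ℓ i), (cyclesGraph ℓ).Adj x y ↔
      y = ⟨x.1, x.2 + 1⟩ ∨ x = ⟨y.1, y.2 + 1⟩ := by
    rintro ⟨i, u⟩ ⟨j, v⟩
    simp only [cyclesGraph, SimpleGraph.iSup_adj, SimpleGraph.map_adj]
    constructor
    · rintro ⟨k, u', v', huv, h1, h2⟩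
      simp only [Function.Embedding.sigmaMk_apply, Sigma.mk.injEq] at h1 h2
      obtain ⟨rfl, h1⟩ := h1
      obtain ⟨rfl, h2⟩ := h2
      rw [heq_eq_eq] at h1 h2
      subst h1 h2
      rw [cycleGraph_adj_iff_eq_add_one (by have := hℓ k; omega)] at huv
      rcases huv with rfl | rfl <;> simp
    · rintro (h | h)
      · obtain ⟨rfl, h⟩ := Sigma.mk.inj h
        rw [heq_eq_eq] at h
        exact ⟨j, u, v, (cycleGraph_adj_iff_eq_add_one (by have := hℓ j; omega) _ _).2 (Or.inl h),
          rfl, rfl⟩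
      · obtain ⟨rfl, h⟩ := Sigma.mk.inj h
        rw [heq_eq_eq] at h
        exact ⟨i, u, v, (cycleGraph_adj_iff_eq_add_one (by have := hℓ i; omega) _ _).2 (Or.inr h),
          rfl, rfl⟩
  ext e
  induction e using Sym2.ind with
  | _ x y =>
    rw [SimpleGraph.mem_edgeSet, Set.mem_range]
    constructor
    · intro h
      rcases x with x | x <;> rcases y with y | y
      · rcases (hcyc x y).1 h with h | h
        · exact ⟨Sum.inl x, by rw [h]; rfl⟩
        · exact ⟨Sum.inl y, by rw [h]; exact Sym2.eq_swap⟩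
      · exact absurd h (by simp [zillionGraph])
      · exact absurd h (by simp [zillionGraph])
      · have h' : (SimpleGraph.pathGraph (m + 1)).Adj x y := h
        rw [SimpleGraph.pathGraph_adj] at h'
        rcases h' with h' | h'
        · refine ⟨Sum.inr ⟨x, by omega⟩, ?_⟩
          simp only [Sum.elim_inr]
          congr 3
          ext
          simp [h']
        · refine ⟨Sum.inr ⟨y, by omega⟩, ?_⟩
          simp only [Sum.elim_inr]
          rw [Sym2.eq_swap]
          congr 3
          ext
          simp [h']
    · rintro ⟨x' | j, h⟩
      · rw [Sum.elim_inl] at h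
        rw [← SimpleGraph.mem_edgeSet, ← h]
        exact (hcyc x' ⟨x'.1, x'.2 + 1⟩).2 (Or.inl rfl)
      · rw [Sum.elim_inr] at h
        rw [← SimpleGraph.mem_edgeSet, ← h]
        have : (SimpleGraph.pathGraph (m + 1)).Adj j.castSucc j.succ := by
          rw [SimpleGraph.pathGraph_adj]
          simp
        exact this

theorem coe_ofFn_eq_sum {n : ℕ} (c : Fin n → ℤ) :
    (List.ofFn c : Multiset ℤ) = ∑ j, {c j} := by
  rw [← Fin.univ_val_map, ← Multiset.sum_map_singleton (Finset.univ.val.map c), Multiset.map_map]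
  rfl

theorem stepDiffs_ofFn {m : ℕ} (g : Fin (m + 1) → ℤ) :
    stepDiffs (List.ofFn g) = ∑ j : Fin m, {|g j.castSucc - g j.succ|} := by
  induction m with
  | zero => simp
  | succ m ih =>
    have := ih (fun j => g j.succ)
    rw [List.ofFn_succ] at this ⊢
    rw [List.ofFn_succ, stepDiffs_cons_cons, Fin.sum_univ_succ, this, Multiset.singleton_add]
    rfl

theorem stepDiffs_closeUp_ofFn {n : ℕ} [NeZero n] (c : Fin n → ℤ) :
    stepDiffs (closeUp (List.ofFn c)) = ∑ j, {|c j - c (j + 1)|} := by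
  obtain ⟨k, rfl⟩ : ∃ k, n = k + 1 := ⟨n - 1, by have := NeZero.ne n; omega⟩
  rw [stepDiffs_closeUp (u := c 0) (v := c (Fin.last k)) (by simp)
      (by rw [List.ofFn_succ', List.concat_eq_append, List.getLast?_concat]),
    stepDiffs_ofFn, Fin.sum_univ_castSucc]
  simp

theorem coe_flatten (C : List (List ℤ)) :
    ((C.flatten : List ℤ) : Multiset ℤ) = (C.map (Multiset.ofList : List ℤ → Multiset ℤ)).sum := by
  induction C with
  | nil => rfl
  | cons c C ih => rw [List.flatten_cons, ← Multiset.coe_add, ih, List.map_cons, List.sum_cons]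

theorem exists_eq_ofFn {α : Type*} {n : ℕ} (l : List α) (h : l.length = n) :
    ∃ g : Fin n → α, l = List.ofFn g := by
  subst h
  exact ⟨l.get, (List.ofFn_get l).symm⟩

theorem exists_eq_ofFn_ofFn {s : ℕ} (ℓ : Fin s → ℕ) {C : List (List ℤ)}
    (hC : C.map List.length = List.ofFn ℓ) :
    ∃ c : ∀ i, Fin (ℓ i) → ℤ, C = List.ofFn fun i => List.ofFn (c i) := by
  obtain ⟨D, hD⟩ := exists_eq_ofFn C (n := s) (by simpa using congrArg List.length hC)
  subst hD
  rw [List.map_ofFn, List.ofFn_inj] at hC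
  choose c hc using fun i => exists_eq_ofFn (D i) (congrFun hC i)
  exact ⟨c, by rw [List.ofFn_inj]; exact funext hc⟩

/-- Both intervals have no repetitions, so the labels and the edge differences are distinct. -/
theorem HasGraceful.exists_isGracefulLabeling {s : ℕ} {ℓ : Fin s → ℕ} {m : ℕ}
    (hℓ : ∀ i, 3 ≤ ℓ i) {x : ℤ}
    (h : HasGraceful (Finset.univ.val.map ℓ) (m + ∑ i, ℓ i : ℕ) x) :
    ∃ f, IsGracefulLabeling (zillionGraph ℓ m) f := by
  have : ∀ i, NeZero (ℓ i) := fun i => ⟨by have := hℓ i; omega⟩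
  obtain ⟨C₀, p, hC₀, hp⟩ := h
  rw [Fin.univ_val_map, Multiset.coe_eq_coe] at hC₀
  -- the cycles are listed in the order of their lengths `ℓ 0, …, ℓ (s - 1)`
  obtain ⟨C, hC, hCC₀⟩ : Relation.Comp (fun L C => L = List.map List.length C) List.Perm (List.ofFn ℓ) C₀ := by
    rw [List.eq_map_comp_perm]
    exact hC₀.symm
  obtain ⟨c, rfl⟩ := exists_eq_ofFn_ofFn ℓ hC.symm
  have hlab := hp.labels
  have hdiff := hp.diffs
  rw [allLabels, ← Multiset.coe_add, coe_flatten, ← (hCC₀.map _).sum_eq, List.map_ofFn,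
    List.sum_ofFn] at hlab
  rw [allDiffs, ← (hCC₀.map _).sum_eq, List.map_ofFn, List.sum_ofFn] at hdiff
  simp only [Function.comp_apply] at hlab hdiff
  have hplen : p.length = m + 1 := by
    have := congrArg Multiset.card hlab
    rw [Multiset.card_add, Multiset.card_sum, card_Ico_int, Multiset.coe_card] at this
    simp only [Multiset.coe_card, List.length_ofFn] at this
    omega
  obtain ⟨g, rfl⟩ := exists_eq_ofFn p hplen
  obtain ⟨f, hf⟩ : ∃ f : (Σ i : Fin s, Fin (ℓ i)) ⊕ Fin (m + 1) → ℤ,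
      f = Sum.elim (fun y => c y.1 y.2) g := ⟨_, rfl⟩
  obtain ⟨e, he⟩ : ∃ e : (Σ i : Fin s, Fin (ℓ i)) ⊕ Fin m →
      Sym2 ((Σ i : Fin s, Fin (ℓ i)) ⊕ Fin (m + 1)), e = Sum.elim
      (fun x : Σ i, Fin (ℓ i) => s(Sum.inl x, Sum.inl ⟨x.1, x.2 + 1⟩))
      (fun j : Fin m => s(Sum.inr j.castSucc, Sum.inr j.succ)) := ⟨_, rfl⟩
  have hE : (zillionGraph ℓ m).edgeSet = Set.range e := by rw [zillionGraph_edgeSet ℓ m hℓ, he]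
  have hF : Finset.univ.val.map f = Multiset.Ico 0 (((m + ∑ i, ℓ i : ℕ) : ℤ) + 1) := by
    rw [← hlab, ← Multiset.sum_map_singleton (Finset.univ.val.map f), Multiset.map_map,
      ← Finset.sum_eq_multiset_sum, Fintype.sum_sum_type, Fintype.sum_sigma, coe_ofFn_eq_sum, hf]
    simp only [coe_ofFn_eq_sum, Function.comp_apply, Sum.elim_inl, Sum.elim_inr]
  have hD : Finset.univ.val.map (fun y => edgeDiff f (e y)) =
      Multiset.Ico 1 (((m + ∑ i, ℓ i : ℕ) : ℤ) + 1) := by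
    rw [← hdiff, ← Multiset.sum_map_singleton (Finset.univ.val.map _), Multiset.map_map,
      ← Finset.sum_eq_multiset_sum, Fintype.sum_sum_type, Fintype.sum_sigma, stepDiffs_ofFn, hf, he]
    simp only [stepDiffs_closeUp_ofFn, Function.comp_apply, Sum.elim_inl, Sum.elim_inr, edgeDiff,
      Sym2.lift_mk]
  have hinj : ∀ y z, edgeDiff f (e y) = edgeDiff f (e z) → y = z := fun y z hyz =>
    Multiset.inj_on_of_nodup_map (hD ▸ Multiset.nodup_Ico) y (Finset.mem_univ_val y) z
      (Finset.mem_univ_val z) hyz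
  have hcard : (zillionGraph ℓ m).edgeSet.ncard = m + ∑ i, ℓ i := by
    rw [hE, ← Nat.card_coe_set_eq, Nat.card_range_of_injective
      fun y z hyz => hinj y z (congrArg _ hyz)]
    simp [add_comm]
  refine ⟨f, ⟨fun y z hyz => Multiset.inj_on_of_nodup_map (hF ▸ Multiset.nodup_Ico) y
    (Finset.mem_univ_val y) z (Finset.mem_univ_val z) hyz, fun v => ?_, ?_⟩⟩
  · have : f v ∈ Finset.univ.val.map f := Multiset.mem_map_of_mem f (Finset.mem_univ_val v)
    rw [hF, Multiset.mem_Ico] at this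
    rw [hcard, Set.mem_Icc]
    omega
  · rw [hcard, hE]
    refine ⟨?_, ?_, ?_⟩
    · rintro _ ⟨y, rfl⟩
      have : edgeDiff f (e y) ∈ Finset.univ.val.map (fun y => edgeDiff f (e y)) :=
        Multiset.mem_map_of_mem _ (Finset.mem_univ_val y)
      rw [hD, Multiset.mem_Ico] at this
      rw [Set.mem_Icc]
      omega
    · rintro _ ⟨y, rfl⟩ _ ⟨z, rfl⟩ hyz
      rw [hinj y z hyz]
    · intro d hd
      have : d ∈ Finset.univ.val.map (fun y => edgeDiff f (e y)) := by
        rw [hD, Multiset.mem_Ico]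
        rw [Set.mem_Icc] at hd
        omega
      obtain ⟨y, -, hy⟩ := Multiset.mem_map.1 this
      exact ⟨e y, ⟨y, rfl⟩, hy⟩

theorem IsGracefulLabeling.comp_iso {V W : Type*} {G : SimpleGraph V} {H : SimpleGraph W}
    {f : W → ℤ} (hf : IsGracefulLabeling H f) (φ : G ≃g H) : IsGracefulLabeling G (f ∘ φ) := by
  have hmap : ∀ e, edgeDiff (f ∘ φ) e = edgeDiff f (e.map φ) := fun e => by
    induction e using Sym2.ind with
    | _ x y => rfl
  have hbij : Set.BijOn (Sym2.map φ) G.edgeSet H.edgeSet := by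
    refine ⟨?_, (Sym2.map.injective φ.injective).injOn, ?_⟩
    · intro e he
      induction e using Sym2.ind with
      | _ x y => exact φ.map_adj_iff.2 he
    · intro e he
      induction e using Sym2.ind with
      | _ x y =>
        refine ⟨s(φ.symm x, φ.symm y), φ.symm.map_adj_iff.2 he, ?_⟩
        simp
  have hcard : G.edgeSet.ncard = H.edgeSet.ncard := by
    rw [← hbij.image_eq, Set.ncard_image_of_injective _ (Sym2.map.injective φ.injective)]
  refine ⟨hf.injective.comp φ.injective, fun v => ?_, ?_⟩
  · rw [hcard]
    exact hf.mem_Icc (φ v)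
  · rw [hcard]
    exact (hf.bijOn.comp hbij).congr fun e _ => (hmap e).symm

theorem theorem1p4 {V : Type*} (Γ : SimpleGraph V) (s : ℕ) (ℓ : Fin s → ℕ) (m : ℕ)
    (hℓ : ∀ i, 3 ≤ ℓ i) (hΓ : Nonempty (Γ ≃g zillionGraph ℓ m))
    (hm : 6 * max 1 (evenBound ℓ) + 7 * max 3 (oddBound ℓ) + 9 ≤ (m : ℚ)) :
    ∃ f : V → ℤ, IsGracefulLabeling Γ f := by
  obtain ⟨x, hx⟩ := exists_hasGraceful_cycles_path ℓ m hℓ hm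
  obtain ⟨f, hf⟩ := hx.exists_isGracefulLabeling hℓ
  obtain ⟨φ⟩ := hΓ
  exact ⟨f ∘ φ, hf.comp_iso φ⟩
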